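/- Let $\mathscr{H}$ be a (right) Hilbert module over a $C^*$-algebra $\mathfrak{A}$ (not assumed unital), let $\mathcal{L}(\mathscr{H})$ be the $C^*$-algebra of adjointable operators on $\mathscr{H}$, and let $I$ be the identity operator. For $T\in\mathcal{L}(\mathscr{H})$ write $\mathcal{R}(T)$ for its range and $|T|=(T^*T)^{1/2}$, so $|T^*|=(TT^*)^{1/2}$. A submodule $\mathscr{M}$ is orthogonally complemented if $\mathscr{H}=\mathscr{M}+\mathscr{M}^\perp$; in that case $P_{\mathscr{M}}$ denotes the projection of $\mathscr{H}$ onto $\mathscr{M}$ along $\mathscr{M}^\perp$. An operator $T\in\mathcal{L}(\mathscr{H})$ has the polar decomposition if $\overline{\mathcal{R}(T^*)}$ is orthogonally complemented and there is a partial isometry $U\in\mathcal{L}(\mathscr{H})$ with $T=U|T|$ and $U^*U=P_{\overline{\mathcal{R}(T^*)}}$. A pair $(P,Q)$ is a quasi-projection pair if $P\in\mathcal{L}(\mathscr{H})$ is a projection ($P=P^*=P^2$), $Q\in\mathcal{L}(\mathscr{H})$ is an idempotent ($Q^2=Q$), and $$PQ^*P=PQP,\qquad PQ^*(I-P)=-PQ(I-P),\qquad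 (I-P)Q^*(I-P)=(I-P)Q(I-P).$$ A quasi-projection pair $(P,Q)$ is semi-harmonious if both $P(I-Q)$ and $(I-P)Q$ have the polar decomposition. For an idempotent $Q\in\mathcal{L}(\mathscr{H})$ the range $\mathcal{R}(Q)$ is orthogonally complemented, $|Q^*|$ has a Moore-Penrose inverse $|Q^*|^\dagger$ in $\mathcal{L}(\mathscr{H})$, and the matched projection of $Q$ is $$m(Q)=\tfrac12\big(|Q^*|+Q^*\big)\,|Q^*|^\dagger\,\big(|Q^*|+I\big)^{-1}\big(|Q^*|+Q\big).$$ Theorem. For every idempotent $Q\in\mathcal{L}(\mathscr{H})$, its matched pair $(m(Q),Q)$ is a semi-harmonious quasi-projection pair if and only if $P_{\mathcal{R}(Q)}-Q$ has the polar decomposition. -/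

import Mathlib

/-!
Hilbert C⋆-modules over a (not necessarily unital) C⋆-algebra `A` are Mathlib's `CStarModule A E`
on a complete normed space `E`. The `A`-valued inner product is linear in its second variable, with
Mathlib's convention `⟪x, a • y⟫ = a * ⟪x, y⟫`; a right Hilbert module over a C⋆-algebra is the same
thing as such a module over the opposite C⋆-algebra, with the same adjointable operators.
-/

namespace HilbertCStar

section Adjointable

variable (A : Type*) [NonUnitalCStarAlgebra A] [PartialOrder A] [StarOrderedRing A]
variable (E : Type*) [NormedAddCommGroup E] [NormedSpace ℂ E] [SMul A E] [CStarModule A E]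

variable {A E} in
theorem ext_inner_left {x y : E} (h : ∀ z : E, inner A z x = inner A z y) : x = y := by
  have h1 : inner A (x - y) (x - y) = 0 := by
    rw [CStarModule.inner_sub_right, h (x - y), sub_self]
  exact sub_eq_zero.mp (CStarModule.inner_self.mp h1)

variable {A E} in
theorem ext_inner_right {x y : E} (h : ∀ z : E, inner A x z = inner A y z) : x = y := by
  refine ext_inner_left (A := A) fun z => ?_
  rw [← CStarModule.star_inner x z, h z, CStarModule.star_inner]

/-- The algebra `𝓛(E)` of adjointable operators on `E`. -/
def adjointableOperators : Subalgebra ℂ (E →L[ℂ] E) where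
  carrier := {T | ∃ S : E →L[ℂ] E, ∀ x y : E, inner A (T x) y = inner A x (S y)}
  mul_mem' := by
    rintro T₁ T₂ ⟨S₁, h₁⟩ ⟨S₂, h₂⟩
    exact ⟨S₂ * S₁, fun x y => by simp [h₁, h₂]⟩
  add_mem' := by
    rintro T₁ T₂ ⟨S₁, h₁⟩ ⟨S₂, h₂⟩
    exact ⟨S₁ + S₂, fun x y => by simp [h₁, h₂]⟩
  algebraMap_mem' := fun c =>
    ⟨(star c) • 1, fun x y => by simp [Algebra.algebraMap_eq_smul_one]⟩

/-- The type of adjointable operators on `E`. -/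
def Adjointable : Type _ := adjointableOperators A E

/-- The operator norm on `𝓛(E)`, with the pointwise addition and the composition. -/
noncomputable instance : NormedRing (Adjointable A E) :=
  inferInstanceAs (NormedRing (adjointableOperators A E))

noncomputable instance : NormedAlgebra ℂ (Adjointable A E) :=
  inferInstanceAs (NormedAlgebra ℂ (adjointableOperators A E))

variable {A E}

/-- The bounded linear operator underlying an adjointable operator. -/
def Adjointable.toCLM (T : Adjointable A E) : E →L[ℂ] E := T.1

instance : CoeFun (Adjointable A E) (fun _ => E → E) := ⟨fun T => T.toCLM⟩

theorem toCLM_injective :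
    Function.Injective (Adjointable.toCLM : Adjointable A E → E →L[ℂ] E) :=
  Subtype.val_injective

@[simp] theorem mul_apply (T S : Adjointable A E) (x : E) : (T * S) x = T (S x) := rfl
@[simp] theorem add_apply (T S : Adjointable A E) (x : E) : (T + S) x = T x + S x := rfl
@[simp] theorem smul_apply (c : ℂ) (T : Adjointable A E) (x : E) : (c • T) x = c • T x := rfl
theorem norm_def (T : Adjointable A E) : ‖T‖ = ‖T.toCLM‖ := rfl

/-- The adjoint of an adjointable operator. -/
noncomputable instance : Star (Adjointable A E) where
  star T := ⟨T.2.choose, T.toCLM, fun x y => by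
    rw [← CStarModule.star_inner y]
    exact (congrArg star (T.2.choose_spec y x).symm).trans (CStarModule.star_inner _ _)⟩

theorem inner_apply_left (T : Adjointable A E) (x y : E) :
    inner A (T x) y = inner A x ((star T) y) :=
  T.2.choose_spec x y

theorem inner_apply_right (T : Adjointable A E) (x y : E) :
    inner A x (T y) = inner A ((star T) x) y := by
  rw [← CStarModule.star_inner y, ← CStarModule.star_inner (T y), inner_apply_left]

theorem eq_star_of_inner {T S : Adjointable A E}
    (h : ∀ x y : E, inner A (T x) y = inner A x (S y)) : S = star T := by
  refine toCLM_injective (ContinuousLinearMap.ext fun y => ?_)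
  exact ext_inner_left (A := A) fun x => by rw [← h, inner_apply_left]

noncomputable instance : StarRing (Adjointable A E) where
  star_involutive T := (eq_star_of_inner fun x y => by rw [inner_apply_right]).symm
  star_mul T S := (eq_star_of_inner fun x y => by simp [inner_apply_left]).symm
  star_add T S := (eq_star_of_inner fun x y => by simp [inner_apply_left]).symm

instance : StarModule ℂ (Adjointable A E) where
  star_smul c T := (eq_star_of_inner fun x y => by simp [inner_apply_left]).symm

theorem norm_apply_sq_le (T : Adjointable A E) (x : E) :
    ‖T x‖ ^ 2 ≤ ‖star T * T‖ * ‖x‖ ^ 2 := by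
  calc ‖T x‖ ^ 2 = ‖inner A (T x) (T x)‖ := CStarModule.norm_sq_eq A
    _ = ‖inner A x ((star T * T : Adjointable A E) x)‖ := by rw [inner_apply_left, mul_apply]
    _ ≤ ‖x‖ * ‖(star T * T : Adjointable A E) x‖ := CStarModule.norm_inner_le E
    _ ≤ ‖x‖ * (‖star T * T‖ * ‖x‖) := by
      gcongr
      exact ContinuousLinearMap.le_opNorm _ _
    _ = ‖star T * T‖ * ‖x‖ ^ 2 := by ring

instance : CStarRing (Adjointable A E) where
  norm_mul_self_le T := by
    have h2 : √‖star T * T‖ ^ 2 = ‖star T * T‖ := Real.sq_sqrt (norm_nonneg _)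
    have h : ‖T‖ ≤ √‖star T * T‖ := by
      refine ContinuousLinearMap.opNorm_le_bound _ (Real.sqrt_nonneg _) fun x => ?_
      refine (sq_le_sq₀ (norm_nonneg _) (by positivity)).mp ?_
      rw [mul_pow, h2]
      exact norm_apply_sq_le T x
    calc ‖T‖ * ‖T‖ = ‖T‖ ^ 2 := (sq _).symm
      _ ≤ √‖star T * T‖ ^ 2 := by gcongr
      _ = ‖star T * T‖ := h2

variable [CompleteSpace E]

instance : CompleteSpace (Adjointable A E) := by
  refine Metric.complete_of_cauchySeq_tendsto fun u hu => ?_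
  have hu1 : CauchySeq fun n => (u n).toCLM := by
    rw [Metric.cauchySeq_iff] at hu ⊢
    exact hu
  have hu2 : CauchySeq fun n => (star (u n)).toCLM := by
    rw [Metric.cauchySeq_iff] at hu ⊢
    intro ε hε
    obtain ⟨N, hN⟩ := hu ε hε
    refine ⟨N, fun m hm n hn => ?_⟩
    have h := hN m hm n hn
    rw [dist_eq_norm, ← norm_star, star_sub, ← dist_eq_norm] at h
    exact h
  obtain ⟨T, hT⟩ := cauchySeq_tendsto_of_complete hu1
  obtain ⟨S, hS⟩ := cauchySeq_tendsto_of_complete hu2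
  have hTS : ∀ x y : E, inner A (T x) y = inner A x (S y) := by
    intro x y
    have h1 : Filter.Tendsto (fun n => (inner A ((u n).toCLM x) y : A)) Filter.atTop
        (nhds (inner A (T x) y)) :=
      (CStarModule.continuous_inner (A := A) (E := E)).tendsto (T x, y) |>.comp
        (((ContinuousLinearMap.apply ℂ E x).continuous.tendsto T |>.comp hT).prodMk_nhds
          tendsto_const_nhds)
    have h2 : Filter.Tendsto (fun n => (inner A x ((star (u n)).toCLM y) : A)) Filter.atTop
        (nhds (inner A x (S y))) :=
      (CStarModule.continuous_inner (A := A) (E := E)).tendsto (x, S y) |>.comp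
        (tendsto_const_nhds.prodMk_nhds
          ((ContinuousLinearMap.apply ℂ E y).continuous.tendsto S |>.comp hS))
    simp only [← inner_apply_left] at h2
    exact tendsto_nhds_unique h1 h2
  exact ⟨⟨T, S, hTS⟩, tendsto_subtype_rng.mpr hT⟩

/-- The adjointable operators form a unital C⋆-algebra. -/
noncomputable instance : CStarAlgebra (Adjointable A E) where

/-- Positivity in `𝓛(E)` is positivity in the C⋆-algebra sense. -/
noncomputable instance : PartialOrder (Adjointable A E) := CStarAlgebra.spectralOrder _

instance : StarOrderedRing (Adjointable A E) := CStarAlgebra.spectralOrderedRing _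

/-- Every map on a Hilbert module that has an adjoint is a bounded linear operator. -/
theorem exists_adjointable_of_map (T S : E → E)
    (h : ∀ x y : E, inner A (T x) y = inner A x (S y)) :
    ∃ T' : Adjointable A E, ∀ x, T' x = T x := by
  have key : ∀ T S : E → E, (∀ x y : E, inner A (T x) y = inner A x (S y)) →
      ∃ T' : E →L[ℂ] E, ∀ x, T' x = T x := by
    intro T S h
    let L : E →ₗ[ℂ] E :=
      { toFun := T
        map_add' := fun x y => ext_inner_right (A := A) fun z => by
          simp [h]
        map_smul' := fun c x => ext_inner_right (A := A) fun z => by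
          simp [h] }
    have hL : ∀ (u : ℕ → E) (x y : E), Filter.Tendsto u Filter.atTop (nhds x) →
        Filter.Tendsto (L ∘ u) Filter.atTop (nhds y) → y = L x := by
      intro u x y hx hy
      refine ext_inner_right (A := A) fun z => ?_
      have h1 : Filter.Tendsto (fun n => (inner A (L (u n)) z : A)) Filter.atTop
          (nhds (inner A y z)) :=
        (CStarModule.continuous_inner (A := A) (E := E)).tendsto (y, z) |>.comp
          (hy.prodMk_nhds tendsto_const_nhds)
      have h2 : Filter.Tendsto (fun n => (inner A (u n) (S z) : A)) Filter.atTop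
          (nhds (inner A x (S z))) :=
        (CStarModule.continuous_inner (A := A) (E := E)).tendsto (x, S z) |>.comp
          (hx.prodMk_nhds tendsto_const_nhds)
      have h3 : ∀ n, (inner A (L (u n)) z : A) = inner A (u n) (S z) := fun n => h _ _
      simp only [← h3] at h2
      rw [tendsto_nhds_unique h1 h2]
      exact (h x z).symm
    exact ⟨ContinuousLinearMap.ofSeqClosedGraph hL, fun x => rfl⟩
  obtain ⟨T', hT'⟩ := key T S h
  obtain ⟨S', hS'⟩ := key S T fun x y => by
    rw [← CStarModule.star_inner y, ← h, CStarModule.star_inner]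
  exact ⟨⟨T', S', fun x y => by rw [hT', hS', h]⟩, hT'⟩

end Adjointable

section OrthogonalProjection

variable (A : Type*) [NonUnitalCStarAlgebra A] [PartialOrder A] [StarOrderedRing A]
variable {E : Type*} [NormedAddCommGroup E] [NormedSpace ℂ E] [SMul A E] [CStarModule A E]

/-- The orthogonal complement with respect to the `A`-valued inner product. -/
def orthogonal (M : Submodule ℂ E) : Submodule ℂ E where
  carrier := {x | ∀ y ∈ M, inner A x y = 0}
  add_mem' := fun {x y} hx hy z hz => by simp [hx z hz, hy z hz]
  zero_mem' := fun z _ => by simp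
  smul_mem' := fun c x hx z hz => by simp [hx z hz]

/-- `M` is orthogonally complemented if `E = M + M^⊥`. (Then `M = M^⊥⊥`, so that `M` is
automatically a closed `A`-submodule.) -/
def IsOrthogonallyComplemented (M : Submodule ℂ E) : Prop :=
  M ⊔ orthogonal A M = ⊤

variable {A}

theorem eq_zero_of_mem_orthogonal {M : Submodule ℂ E} {x : E} (h : x ∈ M)
    (h' : x ∈ orthogonal A M) : x = 0 :=
  CStarModule.inner_self.mp (h' x h)

variable [CompleteSpace E]

theorem exists_orthogonalProjection {M : Submodule ℂ E} (hM : IsOrthogonallyComplemented A M) :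
    ∃ P : Adjointable A E, ∀ x : E, P x ∈ M ∧ x - P x ∈ orthogonal A M := by
  have h : ∀ x : E, ∃ m ∈ M, x - m ∈ orthogonal A M := by
    intro x
    obtain ⟨m, hm, n, hn, e⟩ := Submodule.mem_sup.mp (hM ▸ Submodule.mem_top : x ∈ M ⊔ _)
    exact ⟨m, hm, by rwa [← e, add_sub_cancel_left]⟩
  choose p hp hp' using h
  have key : ∀ x y : E, inner A (p x) y = inner A x (p y) := by
    intro x y
    have h1 : inner A (x - p x) (p y) = 0 := hp' x _ (hp y)
    have h2 : inner A (y - p y) (p x) = 0 := hp' y _ (hp x)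
    rw [CStarModule.inner_sub_left, sub_eq_zero] at h1 h2
    rw [h1, ← CStarModule.star_inner y, h2, CStarModule.star_inner]
  obtain ⟨P, hP⟩ := exists_adjointable_of_map p p key
  exact ⟨P, fun x => by rw [hP]; exact ⟨hp x, hp' x⟩⟩

/-- The projection `P_M` of `E` onto an orthogonally complemented submodule `M`. -/
noncomputable def orthogonalProjection (M : Submodule ℂ E)
    (hM : IsOrthogonallyComplemented A M) : Adjointable A E :=
  (exists_orthogonalProjection hM).choose

theorem orthogonalProjection_spec {M : Submodule ℂ E} (hM : IsOrthogonallyComplemented A M)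
    (x : E) : (orthogonalProjection M hM) x ∈ M ∧
      x - (orthogonalProjection M hM) x ∈ orthogonal A M :=
  (exists_orthogonalProjection hM).choose_spec x

end OrthogonalProjection

section Algebra

variable {B : Type*} [CStarAlgebra B] [PartialOrder B] [StarOrderedRing B]

/-- The range projection of an idempotent, described algebraically. -/
theorem exists_rangeProjection {q : B} (hq : IsIdempotentElem q) :
    ∃ p : B, IsStarProjection p ∧ p * q = q ∧ q * p = p := by
  have hq' : q * q = q := hq
  have hqs : star q * star q = star q := by rw [← star_mul, hq']
  have hsa : IsSelfAdjoint (q + star q - 1) := by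
    simp [IsSelfAdjoint, add_comm]
  have hsq : (q + star q - 1) * (q + star q - 1) = 1 + star (q - star q) * (q - star q) := by
    simp only [star_sub, star_star, mul_sub, sub_mul, mul_add, add_mul, hq', hqs, mul_one, one_mul]
    abel
  have hu2 : IsUnit ((q + star q - 1) * (q + star q - 1)) := by
    rw [hsq]
    refine CStarAlgebra.isUnit_of_le 1 ?_
    exact le_add_of_nonneg_right (star_mul_self_nonneg _)
  have hu : IsUnit (q + star q - 1) :=
    ((Commute.refl (q + star q - 1)).isUnit_mul_iff.mp hu2).1
  obtain ⟨u, hu⟩ := hu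
  have hus : star (u : B) = u := by rw [hu]; exact hsa
  have huis : star (↑u⁻¹ : B) = ↑u⁻¹ := by
    have h1 : (u : B) * star (↑u⁻¹ : B) = 1 := by
      rw [← hus, ← star_mul]; simp
    exact Units.eq_inv_of_mul_eq_one_left h1
  have hqu : q * u = q * star q := by rw [hu]; simp [mul_sub, mul_add, hq']
  have huq : u * star q = q * star q := by rw [hu]; simp [sub_mul, add_mul, hqs]
  have huq' : u * q = star q * q := by rw [hu]; simp [sub_mul, add_mul, hq']
  have hqu' : star q * u = star q * q := by rw [hu]; simp [mul_sub, mul_add, hqs]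
  have hcomm : q * ↑u⁻¹ = ↑u⁻¹ * star q := by
    rw [Units.eq_inv_mul_iff_mul_eq, ← mul_assoc, Units.mul_inv_eq_iff_eq_mul, huq', hqu']
  have hqvq : q * ↑u⁻¹ * q = q := by
    rw [hcomm, mul_assoc, ← huq', ← mul_assoc, Units.inv_mul, one_mul]
  refine ⟨q * ↑u⁻¹, ⟨?_, ?_⟩, hqvq, ?_⟩
  · show q * ↑u⁻¹ * (q * ↑u⁻¹) = q * ↑u⁻¹
    rw [← mul_assoc, hqvq]
  · show star _ = _
    rw [star_mul, huis, hcomm]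
  · rw [← mul_assoc, hq']

/-- `x` is the Moore-Penrose inverse of `t`. -/
structure IsMoorePenroseInverse (t x : B) : Prop where
  mul_mul_self : t * x * t = t
  mul_mul_inv : x * t * x = x
  star_mul_inv : star (t * x) = t * x
  star_inv_mul : star (x * t) = x * t

/-- The Moore-Penrose inverse of `t`, when it exists. -/
noncomputable def moorePenroseInverse (t : B) (h : ∃ x, IsMoorePenroseInverse t x) : B :=
  h.choose

theorem moorePenroseInverse_spec {t : B} (h : ∃ x, IsMoorePenroseInverse t x) :
    IsMoorePenroseInverse t (moorePenroseInverse t h) :=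
  h.choose_spec

theorem IsMoorePenroseInverse.unique {t x y : B} (hx : IsMoorePenroseInverse t x)
    (hy : IsMoorePenroseInverse t y) : x = y := by
  have h1 : t * x = t * y := by
    calc t * x = star (t * x) := hx.star_mul_inv.symm
      _ = star ((t * y) * (t * x)) := by rw [← mul_assoc, hy.mul_mul_self]
      _ = (t * x) * (t * y) := by rw [star_mul, hx.star_mul_inv, hy.star_mul_inv]
      _ = t * y := by rw [← mul_assoc, hx.mul_mul_self]
  have h2 : x * t = y * t := by
    calc x * t = star (x * t) := hx.star_inv_mul.symm
      _ = star ((x * t) * (y * t)) := by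
        rw [mul_assoc, ← mul_assoc t, hy.mul_mul_self]
      _ = (y * t) * (x * t) := by rw [star_mul, hx.star_inv_mul, hy.star_inv_mul]
      _ = y * t := by rw [mul_assoc, ← mul_assoc t, hx.mul_mul_self]
  rw [← hx.mul_mul_inv, h2, mul_assoc, h1, ← mul_assoc, hy.mul_mul_inv]

theorem exists_moorePenroseInverse_abs_star {q : B} (hq : IsIdempotentElem q) :
    ∃ x, IsMoorePenroseInverse (CFC.abs (star q)) x := by
  obtain ⟨p, hp, hpq, hqp⟩ := exists_rangeProjection hq
  have hps : star p = p := hp.isSelfAdjoint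
  have hpp : p * p = p := hp.isIdempotentElem
  set s := CFC.abs (star q) with hs
  have hss : s * s = q * star q := by rw [hs, CFC.abs_mul_abs, star_star]
  have hsa : star s = s := (CFC.abs_nonneg (star q)).isSelfAdjoint
  have hqps : star q * p = star q := by rw [← hps, ← star_mul, hpq]
  have hpqs : p * star q = p := by rw [← hps, ← star_mul, hqp]
  have hsp : s * p = s := by
    have h : star (s * (1 - p)) * (s * (1 - p)) = 0 := by
      rw [star_mul, hsa, mul_assoc, ← mul_assoc s, hss, mul_assoc, mul_sub, mul_one, hqps,
        sub_self, mul_zero, mul_zero]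
    rw [CStarRing.star_mul_self_eq_zero_iff, mul_sub, mul_one, sub_eq_zero] at h
    exact h.symm
  have hps' : p * s = s := by
    have h := congrArg star hsp
    rwa [star_mul, hsa, hps] at h
  have hd : q * star q + 1 - p = 1 + star (star (q - p)) * star (q - p) := by
    rw [star_star, star_sub, hps, mul_sub, sub_mul, sub_mul, hqp, hpqs, hpp]
    abel
  have hu : IsUnit (q * star q + 1 - p) := by
    rw [hd]
    exact CStarAlgebra.isUnit_of_le 1 (le_add_of_nonneg_right (star_mul_self_nonneg _))
  obtain ⟨u, hu⟩ := hu
  have hus : (u : B) * s = s * u := by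
    rw [hu, ← hss]
    simp [mul_sub, sub_mul, mul_add, add_mul, hsp, hps', mul_assoc]
  have hpu : p * u = s * s := by
    rw [hu, hss]
    simp [mul_sub, mul_add, hpp, ← mul_assoc, hpq]
  have hvs : ↑u⁻¹ * s = s * ↑u⁻¹ := by
    rw [Units.inv_mul_eq_iff_eq_mul, ← mul_assoc, Units.eq_mul_inv_iff_mul_eq, hus]
  have h1 : s * (s * ↑u⁻¹) = p := by
    rw [← mul_assoc, Units.mul_inv_eq_iff_eq_mul, hpu]
  have h2 : s * ↑u⁻¹ * s = p := by
    rw [mul_assoc, hvs, h1]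
  exact ⟨s * ↑u⁻¹, by rw [h1, hps'], by rw [h2, ← mul_assoc, hps'], by rw [h1, hps],
    by rw [h2, hps]⟩

theorem isUnit_abs_add_one (t : B) : IsUnit (CFC.abs t + 1) :=
  CStarAlgebra.isUnit_of_le 1 (le_add_of_nonneg_left (CFC.abs_nonneg t))

/-- The matched projection `m(q) = ½ (|q*| + q*) |q*|† (|q*| + 1)⁻¹ (|q*| + q)` of an
idempotent `q`. (The inverse exists by `isUnit_abs_add_one`.) -/
noncomputable def matchedProjection (q : B) (hq : IsIdempotentElem q) : B :=
  (1 / 2 : ℂ) • ((CFC.abs (star q) + star q) *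
    moorePenroseInverse (CFC.abs (star q)) (exists_moorePenroseInverse_abs_star hq) *
    Ring.inverse (CFC.abs (star q) + 1) * (CFC.abs (star q) + q))

/-- `(p, q)` is a quasi-projection pair. -/
structure IsQuasiProjectionPair (p q : B) : Prop where
  isStarProjection : IsStarProjection p
  isIdempotentElem : IsIdempotentElem q
  corner : p * star q * p = p * q * p
  offDiagonal : p * star q * (1 - p) = -(p * q * (1 - p))
  corner_compl : (1 - p) * star q * (1 - p) = (1 - p) * q * (1 - p)

end Algebra

section PolarDecomposition

variable {A : Type*} [NonUnitalCStarAlgebra A] [PartialOrder A] [StarOrderedRing A]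
variable {E : Type*} [NormedAddCommGroup E] [NormedSpace ℂ E] [SMul A E] [CStarModule A E]
variable [CompleteSpace E]

/-- The range of an adjointable operator. -/
def range (T : Adjointable A E) : Submodule ℂ E :=
  LinearMap.range (T.toCLM : E →ₗ[ℂ] E)

theorem isOrthogonallyComplemented_range {Q : Adjointable A E} (hQ : IsIdempotentElem Q) :
    IsOrthogonallyComplemented A (range Q) := by
  obtain ⟨P, hP, hPQ, hQP⟩ := exists_rangeProjection hQ
  have hPs : star P = P := hP.isSelfAdjoint
  refine Submodule.eq_top_iff'.mpr fun x => ?_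
  refine Submodule.mem_sup.mpr ⟨P x, ⟨P x, ?_⟩, x - P x, ?_, by abel⟩
  · exact congrArg (fun T : Adjointable A E => T x) hQP
  · rintro _ ⟨y, rfl⟩
    have h1 : P (Q y) = Q y := congrArg (fun T : Adjointable A E => T y) hPQ
    show inner A (x - P x) (Q y) = 0
    rw [CStarModule.inner_sub_left, inner_apply_left, hPs, h1, sub_self]

/-- `T` has the polar decomposition: `T = U|T|` with a partial isometry `U` such that `U*U` is
the projection onto the closure of the range of `T*` (which has to be orthogonally
complemented). -/
def HasPolarDecomposition (T : Adjointable A E) : Prop :=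
  ∃ U : Adjointable A E, U * star U * U = U ∧ T = U * CFC.abs T ∧
    ∃ h : IsOrthogonallyComplemented A (range (star T)).topologicalClosure,
      star U * U = orthogonalProjection (range (star T)).topologicalClosure h

/-- A semi-harmonious quasi-projection pair. -/
structure IsSemiHarmonious (P Q : Adjointable A E) : Prop where
  isQuasiProjectionPair : IsQuasiProjectionPair P Q
  hasPolarDecomposition_left : HasPolarDecomposition (P * (1 - Q))
  hasPolarDecomposition_right : HasPolarDecomposition ((1 - P) * Q)

end PolarDecomposition

end HilbertCStar

/-! Write `p` for the projection onto the range of `q`, `s = |q*|`, `t = s†`, `u = (s + 1)⁻¹` and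
`m` for the matched projection. That `(m, q)` is a quasi-projection pair is an algebraic identity
valid for every idempotent, so only the two polar decompositions matter.

Both operators are multiples of `p - q` or its adjoint: `m (1 - q) = z (p - q)` with `z = ½ (s + q*)
u`, and `(1 - m) q = z' (p - q)* (t q)` with `z' = ½ (u (p - q) + 1)`. In each case explicit
multipliers recover `p - q` or `(p - q)*`.

On the module side, `T` has the polar decomposition exactly when the closures of the ranges of `T`
and `T*` are both complemented (`hasPolarDecomposition_iff`). This criterion is symmetric in `T` and
`T*`, and it is unchanged when `T` is replaced by `z T k`, provided `y z T = T` and `T k l = T` for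
some `y`, `l` (`hasPolarDecomposition_mul_mul_iff`). Hence each of the two polar decompositions is
separately equivalent to that of `p - q`. -/

namespace HilbertCStar

/-! ### Approximate factorization in a C⋆-algebra. -/

section Algebra

variable {B : Type*} [CStarAlgebra B] [PartialOrder B] [StarOrderedRing B]

/-- Every element of a C⋆-algebra is approximated by elements of the right ideal generated by
`b * star b`. -/
theorem exists_norm_sub_mul_star_mul_le (b : B) {ε : ℝ} (hε : 0 < ε) :
    ∃ y : B, ‖b - b * star b * y‖ ^ 2 ≤ ε := by
  set c : B := b * star b with hc
  have hc0 : 0 ≤ c := mul_star_self_nonneg b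
  have hpos : ∀ r ∈ spectrum ℝ c, 0 ≤ r := fun r hr => spectrum_nonneg_of_nonneg hc0 hr
  have hg : ContinuousOn (fun r : ℝ => (r + ε)⁻¹) (spectrum ℝ c) :=
    ContinuousOn.inv₀ (by fun_prop) fun r hr => by have := hpos r hr; positivity
  -- Here `d = (c + ε)⁻¹`, so the error is `e b` with `e = ε (c + ε)⁻¹`. Its squared norm is `‖e c
  -- e‖`, the supremum of `ε² r / (r + ε)²` over the spectrum, which is at most `ε`.
  set d : B := cfc (fun r : ℝ => (r + ε)⁻¹) c
  refine ⟨d * b, ?_⟩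
  set e : B := cfc (fun r : ℝ => 1 - r * (r + ε)⁻¹) c with he
  have hesa : star e = e := IsSelfAdjoint.star_eq (cfc_predicate _ _)
  have he' : e = 1 - c * d := by
    rw [he, cfc_sub (fun _ => (1 : ℝ)) (fun r => r * (r + ε)⁻¹) c (by fun_prop)
      (by fun_prop), cfc_const_one ℝ c, cfc_mul (fun r : ℝ => r) (fun r => (r + ε)⁻¹) c
      (by fun_prop) hg, cfc_id' ℝ c]
  have h1 : b - c * (d * b) = e * b := by
    rw [he', sub_mul, one_mul, mul_assoc c d b]
  have h2 : e * c * e = cfc (fun r : ℝ => (1 - r * (r + ε)⁻¹) * r * (1 - r * (r + ε)⁻¹)) c := by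
    rw [cfc_mul (fun r : ℝ => (1 - r * (r + ε)⁻¹) * r) (fun r => 1 - r * (r + ε)⁻¹) c
      (by fun_prop) (by fun_prop), cfc_mul (fun r : ℝ => (1 - r * (r + ε)⁻¹)) (fun r => r) c
      (by fun_prop) (by fun_prop), cfc_id' ℝ c]
  rw [h1, sq, ← CStarRing.norm_self_mul_star, star_mul, hesa, ← mul_assoc, mul_assoc e b, ← hc, h2]
  refine norm_cfc_le hε.le fun r hr => ?_
  have hr0 := hpos r hr
  have h3 : (1 - r * (r + ε)⁻¹) * r * (1 - r * (r + ε)⁻¹) = ε * (ε * r / (r + ε) ^ 2) := by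
    field_simp
    ring
  rw [h3, Real.norm_of_nonneg (by positivity)]
  refine mul_le_of_le_one_right hε.le ?_
  rw [div_le_one (by positivity)]
  nlinarith [mul_nonneg hr0 hε.le, sq_nonneg r, sq_nonneg ε]

end Algebra

/-! ### Identities for an idempotent and its matched projection. -/

section IdempotentData

variable {B : Type*} [CStarAlgebra B]

/-- The relations between an idempotent `q`, its range projection `p`, `s = |q*|`, `t = s†` and
`u = (s + 1)⁻¹`. -/
structure IsIdempotentData (q p s t u : B) : Prop where
  q_mul_q : q * q = q
  star_p : star p = p
  p_mul_p : p * p = p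
  p_mul_q : p * q = q
  q_mul_p : q * p = p
  star_s : star s = s
  s_mul_s : s * s = q * star q
  p_mul_s : p * s = s
  s_mul_p : s * p = s
  q_mul_s : q * s = s
  s_mul_t : s * t = p
  t_mul_s : t * s = p
  star_t : star t = t
  star_u : star u = u
  u_mul : u * (s + 1) = 1
  mul_u : (s + 1) * u = 1

namespace IsIdempotentData

variable {q p s t u : B}

theorem of_abs [PartialOrder B] [StarOrderedRing B] (hq : IsIdempotentElem q) (hp : IsStarProjection p)
    (hpq : p * q = q) (hqp : q * p = p)
    (ht : IsMoorePenroseInverse (CFC.abs (star q)) t) :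
    IsIdempotentData q p (CFC.abs (star q)) t (Ring.inverse (CFC.abs (star q) + 1)) := by
  have hps : star p = p := hp.isSelfAdjoint
  have hpp : p * p = p := hp.isIdempotentElem
  have hunit := isUnit_abs_add_one (star q)
  have hss : CFC.abs (star q) * CFC.abs (star q) = q * star q := by
    rw [CFC.abs_mul_abs, star_star]
  have hsa : star (CFC.abs (star q)) = CFC.abs (star q) :=
    (CFC.abs_nonneg (star q)).isSelfAdjoint
  generalize CFC.abs (star q) = s at *
  -- Since `s s = q q*`, the elements `x s` and `x q` vanish together, and `q`, `p` are right
  -- multiples of each other. The relations of `p` with `s` and `t` all follow by this cancellation.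
  have left_cancel : ∀ x : B, x * s = 0 ↔ x * p = 0 := by
    intro x
    have h1 : x * s = 0 ↔ x * q = 0 := by
      rw [← CStarRing.mul_star_self_eq_zero_iff (x * s),
        ← CStarRing.mul_star_self_eq_zero_iff (x * q), star_mul, star_mul, hsa, mul_assoc x s,
        ← mul_assoc s s, hss, mul_assoc x q, mul_assoc q]
    rw [h1]
    constructor <;> intro h
    · rw [← hqp, ← mul_assoc, h, zero_mul]
    · rw [← hpq, ← mul_assoc, h, zero_mul]
  have hps' : p * s = s := by
    have h := (left_cancel (1 - p)).mpr (by rw [sub_mul, one_mul, hpp, sub_self])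
    rw [sub_mul, one_mul, sub_eq_zero] at h
    exact h.symm
  have hsp : s * p = s := by
    have h := congrArg star hps'
    rwa [star_mul, hsa, hps] at h
  have hqs : q * s = s := by rw [← hps', ← mul_assoc, hqp]
  have hst : s * t = p := by
    have h := (left_cancel (1 - s * t)).mp (by rw [sub_mul, one_mul, ht.mul_mul_self, sub_self])
    rw [sub_mul, one_mul, sub_eq_zero] at h
    have h2 := congrArg star h
    rw [star_mul, ht.star_mul_inv, hps, ← mul_assoc, hps'] at h2
    exact h2.symm
  have hts : t * s = p := by
    have h0 : (1 - t * s) * s = 0 := by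
      have h1 := congrArg star ht.mul_mul_self
      rw [mul_assoc, star_mul, ht.star_inv_mul, hsa] at h1
      rw [sub_mul, one_mul, h1, sub_self]
    have h := (left_cancel _).mp h0
    rw [sub_mul, one_mul, mul_assoc, hsp, sub_eq_zero] at h
    exact h.symm
  have hpt : p * t = t := by rw [← hts, ht.mul_mul_inv]
  have htp : t * p = t := by rw [← hst, ← mul_assoc, ht.mul_mul_inv]
  have hstar_t : star t = t := by
    calc star t = star (t * (s * t)) := by rw [hst, htp]
      _ = (p * star t) := by rw [star_mul, ht.star_mul_inv, hst]
      _ = t * star (t * s) := by rw [star_mul, hsa, ← mul_assoc, hts]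
      _ = t := by rw [hts, hps, htp]
  have hstar_u : star (Ring.inverse (s + 1)) = Ring.inverse (s + 1) := by
    rw [← Ring.inverse_star, star_add, hsa, star_one]
  exact ⟨hq, hps, hpp, hpq, hqp, hsa, hss, hps', hsp, hqs, hst, hts, hstar_t,
    hstar_u, Ring.inverse_mul_cancel _ hunit, Ring.mul_inverse_cancel _ hunit⟩

theorem p_mul_star_q (h : IsIdempotentData q p s t u) : p * star q = p := by
  have h1 := congrArg star h.q_mul_p
  rwa [star_mul, h.star_p] at h1

theorem star_q_mul_p (h : IsIdempotentData q p s t u) : star q * p = star q := by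
  have h1 := congrArg star h.p_mul_q
  rwa [star_mul, h.star_p] at h1

theorem u_mul_comm (h : IsIdempotentData q p s t u) {x : B} (hx : Commute s x) :
    u * x = x * u := by
  have hx' : (s + 1) * x = x * (s + 1) := (hx.add_left (Commute.one_left x)).eq
  calc u * x = u * x * ((s + 1) * u) := by rw [h.mul_u, mul_one]
    _ = u * (s + 1) * x * u := by simp only [mul_assoc, ← hx', ← mul_assoc x]
    _ = x * u := by rw [h.u_mul, one_mul]

theorem u_mul_p (h : IsIdempotentData q p s t u) : u * p = p * u :=
  h.u_mul_comm (h.s_mul_p.trans h.p_mul_s.symm)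

theorem u_mul_t (h : IsIdempotentData q p s t u) : u * t = t * u :=
  h.u_mul_comm (h.s_mul_t.trans h.t_mul_s.symm)

theorem u_mul_s_add (h : IsIdempotentData q p s t u) : u * (s * s + s) = s := by
  have : s * s + s = (s + 1) * s := by rw [add_mul, one_mul]
  rw [this, ← mul_assoc, h.u_mul, one_mul]

/-- On the corner of `p`, the product `t u` inverts `s (s + 1) = s * s + s`. -/
theorem add_star_mul_tu_mul (h : IsIdempotentData q p s t u) :
    (s + star q) * t * u * (s * s + s) = s + star q := by
  rw [mul_assoc, h.u_mul_s_add, mul_assoc, h.t_mul_s, add_mul, h.s_mul_p, h.star_q_mul_p]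

/-- The expression defining the matched projection. -/
noncomputable def matched (q s t u : B) : B :=
  (1 / 2 : ℂ) • ((s + star q) * t * u * (s + q))

theorem star_matched (h : IsIdempotentData q p s t u) :
    star (matched q s t u) = matched q s t u := by
  simp only [matched, star_smul, star_mul, star_add, star_star, h.star_s, h.star_t, h.star_u]
  rw [← mul_assoc, ← mul_assoc, mul_assoc (s + star q) u t, h.u_mul_t, ← mul_assoc]
  congr 1
  simp

/-- `q (s + q*) = s + s * s` cancels the middle factor `t u`, leaving `p`. -/
theorem q_mul_matched (h : IsIdempotentData q p s t u) :
    q * matched q s t u = (1 / 2 : ℂ) • (s + q) := by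
  have h1 : q * (s + star q) = s * s + s := by rw [mul_add, h.q_mul_s, h.s_mul_s, add_comm]
  have h2 : (s * s + s) * t * u = p := by
    have h3 : (s * s + s) = (s + 1) * s := by rw [add_mul, one_mul]
    rw [h3, mul_assoc _ s t, h.s_mul_t, mul_assoc, ← h.u_mul_p, ← mul_assoc, h.mul_u, one_mul]
  rw [matched, mul_smul_comm, ← mul_assoc, ← mul_assoc, ← mul_assoc, h1, h2, mul_add, h.p_mul_s,
    h.p_mul_q]

theorem matched_mul_star_q (h : IsIdempotentData q p s t u) :
    matched q s t u * star q = (1 / 2 : ℂ) • (s + star q) := by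
  have h1 := congrArg star h.q_mul_matched
  rw [star_mul, h.star_matched, star_smul, star_add, h.star_s] at h1
  rw [h1]
  simp

/-- `(s + q) q = (s + 1) q` absorbs `u`. -/
theorem matched_mul_q (h : IsIdempotentData q p s t u) :
    matched q s t u * q = (1 / 2 : ℂ) • ((s + star q) * t * q) := by
  have h1 : (s + q) * q = (s + 1) * q := by rw [add_mul, add_mul, h.q_mul_q, one_mul]
  rw [matched, smul_mul_assoc, mul_assoc _ (s + q), h1, mul_assoc _ u, ← mul_assoc u, h.u_mul,
    one_mul]

theorem star_q_mul_matched (h : IsIdempotentData q p s t u) :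
    star q * matched q s t u = (1 / 2 : ℂ) • (star q * t * (s + q)) := by
  have h1 := congrArg star h.matched_mul_q
  rw [star_mul, h.star_matched, star_smul, star_mul, star_mul, star_add, h.star_s, star_star,
    h.star_t, ← mul_assoc] at h1
  rw [h1]
  simp

theorem matched_mul_s (h : IsIdempotentData q p s t u) :
    matched q s t u * s = (1 / 2 : ℂ) • (s + star q) := by
  rw [matched, smul_mul_assoc, mul_assoc, add_mul s q s, h.q_mul_s, h.add_star_mul_tu_mul]

theorem matched_mul_matched (h : IsIdempotentData q p s t u) :
    matched q s t u * matched q s t u = matched q s t u := by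
  -- Idempotency follows because `m` fixes its own leftmost factor.
  have h1 : matched q s t u * (s + star q) = s + star q := by
    rw [mul_add, h.matched_mul_s, h.matched_mul_star_q]
    module
  calc matched q s t u * matched q s t u
      = matched q s t u * ((1 / 2 : ℂ) • ((s + star q) * t * u * (s + q))) := rfl
    _ = matched q s t u := by
      rw [mul_smul_comm, ← mul_assoc, ← mul_assoc, ← mul_assoc, h1, matched]

theorem s_mul_matched (h : IsIdempotentData q p s t u) :
    s * matched q s t u = (1 / 2 : ℂ) • (s + q) := by
  have h1 := congrArg star h.matched_mul_s
  rw [star_mul, h.star_matched, star_smul, star_add, h.star_s, star_star] at h1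
  rw [h1]
  simp

theorem matched_mul_q_mul_matched (h : IsIdempotentData q p s t u) :
    matched q s t u * q * matched q s t u =
      (1 / 4 : ℂ) • (s + star q + (s + star q) * t * q) := by
  rw [mul_assoc, h.q_mul_matched, mul_smul_comm, mul_add, h.matched_mul_s, h.matched_mul_q]
  module

/-- Both sides expand to the self-adjoint element `¼ (s + q + q* + q* t q)`. -/
theorem matched_mul_star_q_mul_matched (h : IsIdempotentData q p s t u) :
    matched q s t u * star q * matched q s t u = matched q s t u * q * matched q s t u := by
  rw [h.matched_mul_q_mul_matched, h.matched_mul_star_q, smul_mul_assoc, add_mul,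
    h.star_q_mul_matched, h.s_mul_matched]
  have h2 : star q * t * s = star q := by rw [mul_assoc, h.t_mul_s, h.star_q_mul_p]
  have h3 : s * t * q = q := by rw [h.s_mul_t, h.p_mul_q]
  simp only [add_mul, mul_add, h2, h3]
  module

theorem isQuasiProjectionPair (h : IsIdempotentData q p s t u) :
    IsQuasiProjectionPair (matched q s t u) q where
  isStarProjection := ⟨h.matched_mul_matched, h.star_matched⟩
  isIdempotentElem := h.q_mul_q
  corner := h.matched_mul_star_q_mul_matched
  offDiagonal := by
    rw [mul_sub, mul_sub, h.matched_mul_star_q_mul_matched, h.matched_mul_q_mul_matched, mul_one,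
      mul_one, h.matched_mul_q, h.matched_mul_star_q]
    module
  corner_compl := by
    have h1 : ∀ m x : B, (1 - m) * x * (1 - m) = x - m * x - x * m + m * x * m := by
      intro m x
      noncomm_ring
    have h2 : star q * t * s = star q := by rw [mul_assoc, h.t_mul_s, h.star_q_mul_p]
    have h3 : s * t * q = q := by rw [h.s_mul_t, h.p_mul_q]
    rw [h1, h1, h.matched_mul_star_q_mul_matched, h.matched_mul_star_q, h.star_q_mul_matched,
      h.matched_mul_q, h.q_mul_matched]
    simp only [add_mul, mul_add, h2, h3]
    module

/-! ### Factorizations through `p - q` and the multipliers that undo them. -/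

theorem p_mul_u_mul_sub (h : IsIdempotentData q p s t u) :
    (s + p) * (u * (p - q)) = p - q := by
  have h1 : s + p = p * (s + 1) := by rw [mul_add, mul_one, h.p_mul_s]
  rw [h1, mul_assoc, ← mul_assoc _ u, h.mul_u, one_mul, mul_sub, h.p_mul_p, h.p_mul_q]

/-- `m(q) (1 - q)` is a left multiple of `p - q`. -/
theorem matched_mul_one_sub (h : IsIdempotentData q p s t u) :
    matched q s t u * (1 - q) = ((1 / 2 : ℂ) • ((s + star q) * u)) * (p - q) := by
  have h1 : (s + q) * (1 - q) = s * (p - q) := by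
    rw [mul_sub, mul_one, add_mul, h.q_mul_q, mul_sub, h.s_mul_p]
    abel
  rw [matched, smul_mul_assoc, smul_mul_assoc, mul_assoc _ (s + q), h1, mul_assoc _ t u,
    ← h.u_mul_t, ← mul_assoc _ u t, mul_assoc _ t, ← mul_assoc t, h.t_mul_s, mul_sub p, h.p_mul_p,
    h.p_mul_q]

/-- `p (s + q*) = s + p = p (s + 1)`, so multiplying by `2p` undoes the left factor of
`matched_mul_one_sub`. -/
theorem mul_matched_factor (h : IsIdempotentData q p s t u) :
    ((2 : ℂ) • p) * ((1 / 2 : ℂ) • ((s + star q) * u)) * (p - q) = p - q := by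
  rw [smul_mul_smul_comm, ← mul_assoc, mul_add, h.p_mul_s, h.p_mul_star_q, smul_mul_assoc,
    mul_assoc, h.p_mul_u_mul_sub]
  norm_num

theorem star_sub_eq (h : IsIdempotentData q p s t u) : star (p - q) = p - star q := by
  rw [star_sub, h.star_p]

/-- `(1 - m(q)) q` is a two-sided multiple of `star (p - q)`. -/
theorem one_sub_matched_mul (h : IsIdempotentData q p s t u) :
    (1 - matched q s t u) * q =
      ((1 / 2 : ℂ) • (u * (p - q) + 1)) * star (p - q) * (t * q) := by
  -- Since `s t q = q`, the left side is `½ (s - q*) t q`. To extract `(p - q)*` from `s - q*`, use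
  -- that `(p - q)(p - q)* = s² - p` factors as `(s + 1)(s - p)`.
  have h1 : (u * (p - q) + 1) * (p - star q) = s - star q := by
    have h2 : (p - q) * (p - star q) = (s + 1) * (s - p) := by
      simp only [mul_sub, sub_mul, add_mul, h.p_mul_p, h.p_mul_star_q, h.q_mul_p, h.s_mul_s,
        h.s_mul_p, one_mul]
      abel
    rw [add_mul, one_mul, mul_assoc, h2, ← mul_assoc, h.u_mul, one_mul]
    abel
  have h3 : s * (t * q) = q := by rw [← mul_assoc, h.s_mul_t, h.p_mul_q]
  rw [h.star_sub_eq, smul_mul_assoc, smul_mul_assoc, h1, sub_mul, one_mul, h.matched_mul_q,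
    mul_assoc, add_mul, sub_mul, h3]
  module

/-- `1 - p` kills `u (p - q)`, because `u` commutes with `p`, and fixes `(p - q)*` from the left. -/
theorem mul_one_sub_matched_factor (h : IsIdempotentData q p s t u) :
    ((2 : ℂ) • (1 - p)) * ((1 / 2 : ℂ) • (u * (p - q) + 1)) * star (p - q) = star (p - q) := by
  have h1 : (1 - p) * (u * (p - q)) = 0 := by
    rw [sub_mul, one_mul, ← mul_assoc p, ← h.u_mul_p, mul_assoc, mul_sub p, h.p_mul_p, h.p_mul_q,
      sub_self]
  rw [smul_mul_smul_comm, mul_add, h1, zero_add, mul_one, smul_mul_assoc, h.star_sub_eq, sub_mul,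
    one_mul, mul_sub p, h.p_mul_p, h.p_mul_star_q, sub_self, sub_zero]
  norm_num

/-- `t q q* t = t s² t = p`, which `(p - q)*` absorbs on the right. -/
theorem star_sub_mul_factor (h : IsIdempotentData q p s t u) :
    star (p - q) * (t * q) * (star q * t) = star (p - q) := by
  have h1 : (t * q) * (star q * t) = p := by
    rw [mul_assoc, ← mul_assoc q, ← h.s_mul_s, mul_assoc, h.s_mul_t, h.s_mul_p, h.t_mul_s]
  rw [mul_assoc, h1, h.star_sub_eq, sub_mul, h.p_mul_p, h.star_q_mul_p]

end IsIdempotentData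

end IdempotentData

/-! ### Polar decompositions on the Hilbert module. -/

section PolarDecomposition

variable {A : Type*} [NonUnitalCStarAlgebra A] [PartialOrder A] [StarOrderedRing A]
variable {E : Type*} [NormedAddCommGroup E] [NormedSpace ℂ E] [SMul A E] [CStarModule A E]

theorem apply_mem_range (T : Adjointable A E) (x : E) : T x ∈ range T := ⟨x, rfl⟩

theorem range_mul_le (T S : Adjointable A E) : range (T * S) ≤ range T := by
  rintro _ ⟨x, rfl⟩
  exact ⟨S x, rfl⟩

theorem map_mem_closure_range (S T : Adjointable A E) {x : E}
    (hx : x ∈ (range T).topologicalClosure) : S x ∈ (range (S * T)).topologicalClosure := by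
  refine map_mem_closure S.toCLM.continuous hx ?_
  rintro _ ⟨y, rfl⟩
  exact ⟨y, rfl⟩

/-- The fixed points of `e` form a closed set contained in `range e`. -/
theorem topologicalClosure_range_le_of_mul_eq {T e : Adjointable A E}
    (h : e * T = T) : (range T).topologicalClosure ≤ range e := by
  have h1 : IsClosed {x : E | e x = x} :=
    isClosed_eq e.toCLM.continuous continuous_id
  intro x hx
  have h2 : e x = x := by
    refine closure_minimal ?_ h1 hx
    rintro _ ⟨y, rfl⟩
    exact congrArg (fun S : Adjointable A E => S y) h
  rw [← h2]
  exact apply_mem_range e x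

variable [CompleteSpace E]

/-! ### Orthogonal projections -/

section Projection

variable {M : Submodule ℂ E} (hM : IsOrthogonallyComplemented A M)

theorem orthogonalProjection_apply_of_mem {x : E} (hx : x ∈ M) :
    orthogonalProjection M hM x = x := by
  obtain ⟨h1, h2⟩ := orthogonalProjection_spec hM x
  exact (sub_eq_zero.mp (eq_zero_of_mem_orthogonal (M.sub_mem hx h1) h2)).symm

theorem isStarProjection_orthogonalProjection : IsStarProjection (orthogonalProjection M hM) := by
  refine ⟨toCLM_injective (ContinuousLinearMap.ext fun x =>
    orthogonalProjection_apply_of_mem hM (orthogonalProjection_spec hM x).1), ?_⟩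
  refine (eq_star_of_inner fun x y => ?_).symm
  have h1 := (orthogonalProjection_spec hM x).2 _ (orthogonalProjection_spec hM y).1
  have h2 := (orthogonalProjection_spec hM y).2 _ (orthogonalProjection_spec hM x).1
  rw [CStarModule.inner_sub_left, sub_eq_zero] at h1 h2
  rw [h1, ← CStarModule.star_inner y, h2, CStarModule.star_inner]

theorem orthogonalProjection_mul_eq {T : Adjointable A E} (h : range T ≤ M) :
    orthogonalProjection M hM * T = T :=
  toCLM_injective (ContinuousLinearMap.ext fun x =>
    orthogonalProjection_apply_of_mem hM (h (apply_mem_range T x)))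

theorem inner_orthogonalProjection_left {x y : E} (hy : y ∈ M) :
    inner A (orthogonalProjection M hM x) y = inner A x y := by
  rw [inner_apply_left, (isStarProjection_orthogonalProjection hM).isSelfAdjoint.star_eq,
    orthogonalProjection_apply_of_mem hM hy]

end Projection

/-! ### Closures of ranges -/

theorem range_le_topologicalClosure_range_mul_star (T : Adjointable A E) :
    range T ≤ (range (T * star T)).topologicalClosure := by
  rintro _ ⟨x, rfl⟩
  refine Metric.mem_closure_iff.mpr fun ε hε => ?_
  obtain ⟨y, hy⟩ := exists_norm_sub_mul_star_mul_le T
    (ε := (ε / (‖x‖ + 1)) ^ 2) (by positivity)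
  refine ⟨(T * star T) (y x), apply_mem_range _ _, ?_⟩
  have h1 : ‖T - T * star T * y‖ ≤ ε / (‖x‖ + 1) :=
    (sq_le_sq₀ (norm_nonneg _) (by positivity)).mp hy
  calc dist (T x) ((T * star T) (y x)) = ‖(T - T * star T * y) x‖ := dist_eq_norm _ _
    _ ≤ ‖T - T * star T * y‖ * ‖x‖ := ContinuousLinearMap.le_opNorm _ _
    _ ≤ ε / (‖x‖ + 1) * ‖x‖ := by gcongr
    _ < ε / (‖x‖ + 1) * (‖x‖ + 1) := by gcongr; linarith
    _ = ε := by field_simp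

theorem topologicalClosure_range_abs (T : Adjointable A E) :
    (range (CFC.abs T)).topologicalClosure = (range (star T)).topologicalClosure := by
  have hsa : star (CFC.abs T) = CFC.abs T := (CFC.abs_nonneg T).isSelfAdjoint
  refine le_antisymm ?_ ?_ <;>
    refine Submodule.topologicalClosure_minimal _ ?_ (Submodule.isClosed_topologicalClosure _)
  · refine (range_le_topologicalClosure_range_mul_star _).trans ?_
    rw [hsa, CFC.abs_mul_abs]
    exact Submodule.topologicalClosure_mono (range_mul_le _ _)
  · refine (range_le_topologicalClosure_range_mul_star _).trans ?_
    rw [star_star, ← CFC.abs_mul_abs]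
    exact Submodule.topologicalClosure_mono (range_mul_le _ _)

theorem inner_abs_apply (T : Adjointable A E) (x y : E) :
    inner A (CFC.abs T x) (CFC.abs T y) = inner A (T x) (T y) := by
  have hsa : star (CFC.abs T) = CFC.abs T := (CFC.abs_nonneg T).isSelfAdjoint
  rw [inner_apply_left, inner_apply_left, hsa, ← mul_apply, ← mul_apply, CFC.abs_mul_abs]

/-! ### The graph of the isometry `|T| x ↦ T x` -/

/-- The closure of the graph of `|T| x ↦ T x`. -/
noncomputable def polarGraph (T : Adjointable A E) : Submodule ℂ (E × E) :=
  (LinearMap.range ((CFC.abs T).toCLM.prod T.toCLM : E →ₗ[ℂ] E × E)).topologicalClosure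

theorem mem_polarGraph (T : Adjointable A E) (x : E) : (CFC.abs T x, T x) ∈ polarGraph T :=
  subset_closure ⟨x, rfl⟩

/-- The identity holds on the graph because `|T|² = T*T`, and passes to the closure one variable at
a time. -/
theorem inner_snd_of_mem_polarGraph {T : Adjointable A E} {v w : E × E} (hv : v ∈ polarGraph T)
    (hw : w ∈ polarGraph T) : inner A v.2 w.2 = inner A v.1 w.1 := by
  have hcont : ∀ {f g : E × E → E}, Continuous f → Continuous g →
      Continuous fun z => (inner A (f z) (g z) : A) := fun hf hg =>
    (CStarModule.continuous_inner (A := A) (E := E)).comp (hf.prodMk hg)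
  have h1 : ∀ x : E, inner A v.2 (T x) = inner A v.1 (CFC.abs T x) := by
    intro x
    have hc : IsClosed {z : E × E | inner A z.2 (T x) = inner A z.1 (CFC.abs T x)} :=
      isClosed_eq (hcont continuous_snd continuous_const) (hcont continuous_fst continuous_const)
    refine closure_minimal ?_ hc hv
    rintro _ ⟨y, rfl⟩
    exact (inner_abs_apply T y x).symm
  have hc : IsClosed {z : E × E | inner A v.2 z.2 = inner A v.1 z.1} :=
    isClosed_eq (hcont continuous_const continuous_snd) (hcont continuous_const continuous_fst)
  refine closure_minimal ?_ hc hw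
  rintro _ ⟨y, rfl⟩
  exact h1 y

theorem norm_snd_of_mem_polarGraph {T : Adjointable A E} {v : E × E} (hv : v ∈ polarGraph T) :
    ‖v.2‖ = ‖v.1‖ := by
  have h := inner_snd_of_mem_polarGraph hv hv
  rw [← sq_eq_sq₀ (norm_nonneg _) (norm_nonneg _), CStarModule.norm_sq_eq A,
    CStarModule.norm_sq_eq A, h]

theorem snd_eq_of_mem_polarGraph {T : Adjointable A E} {x y y' : E} (h : (x, y) ∈ polarGraph T)
    (h' : (x, y') ∈ polarGraph T) : y = y' := by
  have h1 := norm_snd_of_mem_polarGraph ((polarGraph T).sub_mem h h')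
  simpa [sub_eq_zero] using h1

theorem fst_eq_of_mem_polarGraph {T : Adjointable A E} {x x' y : E} (h : (x, y) ∈ polarGraph T)
    (h' : (x', y) ∈ polarGraph T) : x = x' := by
  have h1 := norm_snd_of_mem_polarGraph ((polarGraph T).sub_mem h h')
  simpa [sub_eq_zero, eq_comm] using h1

theorem fst_mem_of_mem_polarGraph {T : Adjointable A E} {v : E × E} (hv : v ∈ polarGraph T) :
    v.1 ∈ (range (CFC.abs T)).topologicalClosure := by
  refine map_mem_closure continuous_fst hv ?_
  rintro _ ⟨x, rfl⟩
  exact ⟨x, rfl⟩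

theorem snd_mem_of_mem_polarGraph {T : Adjointable A E} {v : E × E} (hv : v ∈ polarGraph T) :
    v.2 ∈ (range T).topologicalClosure := by
  refine map_mem_closure continuous_snd hv ?_
  rintro _ ⟨x, rfl⟩
  exact ⟨x, rfl⟩

theorem norm_abs_apply (T : Adjointable A E) (x : E) : ‖CFC.abs T x‖ = ‖T x‖ :=
  (norm_snd_of_mem_polarGraph (mem_polarGraph T x)).symm

theorem exists_snd_mem_polarGraph {T : Adjointable A E} {x : E}
    (hx : x ∈ (range (CFC.abs T)).topologicalClosure) : ∃ y, (x, y) ∈ polarGraph T := by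
  obtain ⟨v, hv, hlim⟩ := mem_closure_iff_seq_limit.mp hx
  choose w hw using hv
  have hc : CauchySeq fun n => T (w n) := by
    have h1 := hlim.cauchySeq
    rw [Metric.cauchySeq_iff] at h1 ⊢
    intro ε hε
    obtain ⟨N, hN⟩ := h1 ε hε
    refine ⟨N, fun m hm n hn => ?_⟩
    have h2 := hN m hm n hn
    rw [← hw, ← hw, dist_eq_norm, ← map_sub] at h2
    rw [dist_eq_norm, ← map_sub, ← norm_abs_apply]
    exact h2
  obtain ⟨y, hy⟩ := cauchySeq_tendsto_of_complete hc
  refine ⟨y, mem_closure_of_tendsto (hlim.prodMk_nhds hy) (.of_forall fun n => ⟨w n, ?_⟩)⟩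
  exact Prod.ext (hw n) rfl

theorem exists_fst_mem_polarGraph {T : Adjointable A E} {y : E}
    (hy : y ∈ (range T).topologicalClosure) : ∃ x, (x, y) ∈ polarGraph T := by
  obtain ⟨v, hv, hlim⟩ := mem_closure_iff_seq_limit.mp hy
  choose w hw using hv
  have hc : CauchySeq fun n => CFC.abs T (w n) := by
    have h1 := hlim.cauchySeq
    rw [Metric.cauchySeq_iff] at h1 ⊢
    intro ε hε
    obtain ⟨N, hN⟩ := h1 ε hε
    refine ⟨N, fun m hm n hn => ?_⟩
    have h2 := hN m hm n hn
    rw [← hw, ← hw, dist_eq_norm, ← map_sub] at h2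
    rw [dist_eq_norm, ← map_sub, norm_abs_apply]
    exact h2
  obtain ⟨x, hx⟩ := cauchySeq_tendsto_of_complete hc
  refine ⟨x, mem_closure_of_tendsto (hx.prodMk_nhds hlim) (.of_forall fun n => ⟨w n, ?_⟩)⟩
  exact Prod.ext rfl (hw n)

/-! ### Polar decompositions and complemented ranges -/

theorem HasPolarDecomposition.isOrthogonallyComplemented_range {T : Adjointable A E}
    (h : HasPolarDecomposition T) :
    IsOrthogonallyComplemented A (range T).topologicalClosure := by
  obtain ⟨U, hU, hT, hM, hUU⟩ := h
  have he : IsIdempotentElem (U * star U) := by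
    rw [IsIdempotentElem, ← mul_assoc, hU]
  suffices hr : (range T).topologicalClosure = range (U * star U) by
    rw [hr]
    exact HilbertCStar.isOrthogonallyComplemented_range he
  refine le_antisymm (topologicalClosure_range_le_of_mul_eq ?_) ?_
  · rw [hT, ← mul_assoc, hU]
  -- `U U* = U (U*U) U*`, where `U*U` lands in the closure of the range of `|T|`; from there `U`
  -- maps into the closure of the range of `U|T| = T`.
  · rintro _ ⟨x, rfl⟩
    have h1 : (star U * U) (star U x) ∈ (range (CFC.abs T)).topologicalClosure := by
      rw [hUU, topologicalClosure_range_abs]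
      exact (orthogonalProjection_spec hM _).1
    have h2 := map_mem_closure_range U _ h1
    rw [← hT, ← mul_apply, ← mul_assoc, hU] at h2
    exact h2

/-- The closed graph of `|T| x ↦ T x` is an isometric bijection between the two closures. Composing
it and its inverse with the projections gives maps `f`, `g` adjoint to each other, and
`exists_adjointable_of_map` then supplies linearity and boundedness. -/
theorem hasPolarDecomposition_of_isOrthogonallyComplemented {T : Adjointable A E}
    (hN : IsOrthogonallyComplemented A (range T).topologicalClosure)
    (hM : IsOrthogonallyComplemented A (range (star T)).topologicalClosure) :
    HasPolarDecomposition T := by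
  have hM' : ∀ x, orthogonalProjection _ hM x ∈ (range (CFC.abs T)).topologicalClosure := by
    intro x
    rw [topologicalClosure_range_abs]
    exact (orthogonalProjection_spec hM x).1
  choose f hf using fun x => exists_snd_mem_polarGraph (hM' x)
  choose g hg using fun y => exists_fst_mem_polarGraph (orthogonalProjection_spec hN y).1
  have hfN : ∀ x, f x ∈ (range T).topologicalClosure := fun x => snd_mem_of_mem_polarGraph (hf x)
  have hgM : ∀ y, g y ∈ (range (star T)).topologicalClosure := fun y => by
    rw [← topologicalClosure_range_abs]
    exact fst_mem_of_mem_polarGraph (hg y)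
  have hfg : ∀ x y : E, inner A (f x) y = inner A x (g y) := by
    intro x y
    rw [← inner_orthogonalProjection_left hM (hgM y), ← CStarModule.star_inner y,
      ← inner_orthogonalProjection_left hN (hfN x), CStarModule.star_inner]
    exact inner_snd_of_mem_polarGraph (hf x) (hg y)
  obtain ⟨U, hU⟩ := exists_adjointable_of_map f g hfg
  have hU' : ∀ y, star U y = g y := fun y => ext_inner_left (A := A) fun x => by
    rw [← inner_apply_left, hU, hfg]
  have hUU : star U * U = orthogonalProjection _ hM := by
    refine toCLM_injective (ContinuousLinearMap.ext fun x => ?_)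
    show star U (U x) = _
    rw [hU', hU]
    have h1 := hg (f x)
    rw [orthogonalProjection_apply_of_mem hN (hfN x)] at h1
    exact fst_eq_of_mem_polarGraph h1 (hf x)
  refine ⟨U, ?_, ?_, hM, hUU⟩
  · rw [mul_assoc, hUU]
    refine toCLM_injective (ContinuousLinearMap.ext fun x => ?_)
    show U (orthogonalProjection _ hM x) = U x
    have h1 := hf (orthogonalProjection _ hM x)
    rw [orthogonalProjection_apply_of_mem hM (orthogonalProjection_spec hM x).1] at h1
    rw [hU, hU]
    exact snd_eq_of_mem_polarGraph h1 (hf x)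
  · refine toCLM_injective (ContinuousLinearMap.ext fun x => ?_)
    show T x = U (CFC.abs T x)
    have h1 := hf (CFC.abs T x)
    rw [orthogonalProjection_apply_of_mem hM (by
      rw [← topologicalClosure_range_abs]
      exact subset_closure (apply_mem_range _ x))] at h1
    rw [hU]
    exact snd_eq_of_mem_polarGraph (mem_polarGraph T x) h1

theorem hasPolarDecomposition_iff (T : Adjointable A E) :
    HasPolarDecomposition T ↔ IsOrthogonallyComplemented A (range T).topologicalClosure ∧
      IsOrthogonallyComplemented A (range (star T)).topologicalClosure :=
  ⟨fun h => ⟨h.isOrthogonallyComplemented_range, h.choose_spec.2.2.choose⟩,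
    fun h => hasPolarDecomposition_of_isOrthogonallyComplemented h.1 h.2⟩

theorem hasPolarDecomposition_star_iff (T : Adjointable A E) :
    HasPolarDecomposition (star T) ↔ HasPolarDecomposition T := by
  rw [hasPolarDecomposition_iff, hasPolarDecomposition_iff, star_star, and_comm]

/-- `y z` is the identity on the closure of the range of `T`. With `f` the projection onto that
closure, `z f y` is an idempotent, not necessarily self-adjoint, whose range is the closure of the
range of `z T`. -/
theorem isOrthogonallyComplemented_closure_range_mul {T z y : Adjointable A E}
    (h : y * z * T = T) (hT : IsOrthogonallyComplemented A (range T).topologicalClosure) :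
    IsOrthogonallyComplemented A (range (z * T)).topologicalClosure := by
  set f := orthogonalProjection _ hT
  have hfT : f * T = T := orthogonalProjection_mul_eq hT subset_closure
  have hff : f * f = f := (isStarProjection_orthogonalProjection hT).isIdempotentElem
  have hyzf : y * z * f = f := by
    have hc : IsClosed {x : E | (y * z) x = x} :=
      isClosed_eq (y * z).toCLM.continuous continuous_id
    refine toCLM_injective (ContinuousLinearMap.ext fun x => ?_)
    refine closure_minimal ?_ hc (orthogonalProjection_spec hT x).1
    rintro _ ⟨w, rfl⟩
    exact congrArg (fun S : Adjointable A E => S w) h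
  have he : IsIdempotentElem (z * f * y) := by
    show z * f * y * (z * f * y) = z * f * y
    calc z * f * y * (z * f * y) = z * f * (y * z * f) * y := by simp only [mul_assoc]
      _ = z * f * y := by rw [hyzf, mul_assoc z f f, hff]
  suffices hr : (range (z * T)).topologicalClosure = range (z * f * y) by
    rw [hr]
    exact isOrthogonallyComplemented_range he
  refine le_antisymm (topologicalClosure_range_le_of_mul_eq ?_) ?_
  · calc z * f * y * (z * T) = z * f * (y * z * T) := by simp only [mul_assoc]
      _ = z * T := by rw [h, mul_assoc, hfT]
  · rintro _ ⟨x, rfl⟩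
    exact map_mem_closure_range z T (orthogonalProjection_spec hT (y x)).1

theorem isOrthogonallyComplemented_closure_range_congr {T z y k l : Adjointable A E}
    (h : y * z * T = T) (h' : T * k * l = T) :
    IsOrthogonallyComplemented A (range (z * T * k)).topologicalClosure ↔
      IsOrthogonallyComplemented A (range T).topologicalClosure := by
  have hr : range (z * T * k) = range (z * T) := by
    refine le_antisymm (range_mul_le _ _) ?_
    conv_lhs => rw [← h', mul_assoc T, ← mul_assoc z, ← mul_assoc]
    exact range_mul_le _ _
  rw [hr]
  -- The converse applies the same lemma to `z T`, with `y` and `z` exchanged, since `y (z T) = T`.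
  refine ⟨fun hT => ?_, isOrthogonallyComplemented_closure_range_mul h⟩
  have h1 : z * y * (z * T) = z * T := by rw [mul_assoc, ← mul_assoc y, h]
  have h2 := isOrthogonallyComplemented_closure_range_mul h1 hT
  rwa [← mul_assoc, h] at h2

/-- The polar decomposition is inherited by two-sided multiples from which the operator can be
recovered. -/
theorem hasPolarDecomposition_mul_mul_iff {T z y k l : Adjointable A E}
    (h : y * z * T = T) (h' : T * k * l = T) :
    HasPolarDecomposition (z * T * k) ↔ HasPolarDecomposition T := by
  have h1 : star l * star k * star T = star T := by
    rw [← star_mul, ← star_mul, ← mul_assoc, h']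
  have h2 : star T * star z * star y = star T := by
    rw [mul_assoc, ← star_mul, ← star_mul, h]
  rw [hasPolarDecomposition_iff, hasPolarDecomposition_iff,
    isOrthogonallyComplemented_closure_range_congr h h', star_mul, star_mul, ← mul_assoc,
    isOrthogonallyComplemented_closure_range_congr h1 h2]

/-- The matched pair of `Q` is a semi-harmonious quasi-projection pair if and only if the
difference of the range projection of `Q` and `Q` has the polar decomposition. -/
theorem isSemiHarmonious_matchedProjection_iff (Q : Adjointable A E) (hQ : IsIdempotentElem Q) :
    IsSemiHarmonious (matchedProjection Q hQ) Q ↔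
      HasPolarDecomposition
        (orthogonalProjection (range Q) (isOrthogonallyComplemented_range hQ) - Q) := by
  have hR := isOrthogonallyComplemented_range hQ
  have hQP : Q * orthogonalProjection (range Q) hR = orthogonalProjection (range Q) hR := by
    refine toCLM_injective (ContinuousLinearMap.ext fun x => ?_)
    obtain ⟨y, hy⟩ := (orthogonalProjection_spec hR x).1
    show Q (orthogonalProjection (range Q) hR x) = orthogonalProjection (range Q) hR x
    rw [← hy]
    exact congrArg (fun S : Adjointable A E => S y) hQ
  have h := IsIdempotentData.of_abs hQ (isStarProjection_orthogonalProjection hR)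
    (orthogonalProjection_mul_eq hR le_rfl) hQP
    (moorePenroseInverse_spec (exists_moorePenroseInverse_abs_star hQ))
  -- With `s`, `t`, `u` the actual absolute value, Moore-Penrose inverse and inverse, `matched` is
  -- `matchedProjection` by definition.
  change IsSemiHarmonious (IsIdempotentData.matched Q _ _ _) Q ↔ _
  have hl := hasPolarDecomposition_mul_mul_iff h.mul_matched_factor (k := 1) (l := 1)
    (by rw [mul_one, mul_one])
  have hr := hasPolarDecomposition_mul_mul_iff h.mul_one_sub_matched_factor h.star_sub_mul_factor
  rw [mul_one, ← h.matched_mul_one_sub] at hl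
  rw [← h.one_sub_matched_mul, hasPolarDecomposition_star_iff] at hr
  -- The polar decomposition of `m (1 - q)` alone gives that of `p - q`, which in turn gives both.
  exact ⟨fun hs => hl.mp hs.hasPolarDecomposition_left,
    fun hp => ⟨h.isQuasiProjectionPair, hl.mpr hp, hr.mpr hp⟩⟩

end PolarDecomposition

end HilbertCStar

theorem mainTheorem3 {A : Type*} [NonUnitalCStarAlgebra A] [PartialOrder A] [StarOrderedRing A]
    {E : Type*} [NormedAddCommGroup E] [NormedSpace ℂ E] [SMul A E] [CStarModule A E]
    [CompleteSpace E] (Q : HilbertCStar.Adjointable A E) (hQ : IsIdempotentElem Q) :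
    HilbertCStar.IsSemiHarmonious (HilbertCStar.matchedProjection Q hQ) Q ↔
      HilbertCStar.HasPolarDecomposition
        (HilbertCStar.orthogonalProjection (HilbertCStar.range Q)
          (HilbertCStar.isOrthogonallyComplemented_range hQ) - Q) :=
  HilbertCStar.isSemiHarmonious_matchedProjection_iff Q hQ
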